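/- Let $F=\bigl(\ast_{i\in I}A_i\bigr)\ast G$ be the free product of nontrivial groups $A_i$ $(i\in I)$ and a free group $G$ with basis $\{g_j\mid j\in J\}$, where $I$ and $J$ are disjoint (possibly empty or infinite) index sets. Let $\mathbf Z(F)$ be the integral group ring of $F$ and $\varepsilon:\mathbf Z(F)\to\mathbf Z$ the augmentation. For $k\in I\cup J$ let $D_k:\mathbf Z(F)\to\mathbf Z(F)$ be the Fox derivative, i.e. the unique map satisfying $$D_k(u+v)=D_k(u)+D_k(v),\qquad D_k(uv)=D_k(u)v+\varepsilon(u)D_k(v)\qquad(u,v\in\mathbf Z(F)),$$ $D_j(g_j)=1$ for $j\in J$ and $D_k(g_j)=0$ for $k\ne j$; $D_i(a)=a-1$ for $i\in I$, $a\in A_i$, and $D_k(a)=0$ for $a\in A_i$, $k\neq i$. Let $N$ be a normal subgroup of $F$; for $u\in\mathbf Z(F)$ write $u\equiv 0\bmod N$ if the image of $u$ under the natural homomorphism $\mathbf Z(F)\to\mathbf Z(F/N)$ is $0$. For a subset $B\subseteq F$ let $B^F$ be the normal subgroup of $F$ generated by $B$. Let $K\subseteq I\cup J$, let $F_K$ be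 the subgroup of $F$ generated by the groups $A_i$ $(i\in K\cap I)$ and the elements $g_j$ $(j\in K\cap J)$, and let $M=P\,[N,N]$, where $P$ is the subgroup generated by all the subgroups $(N\cap A_i)^F$, $i\in I$. Then for every $v\in F$ the following are equivalent: 1. $D_k(v)\equiv 0\bmod N$ for all $k\in(I\cup J)\setminus K$; 2. there is an element $\hat v\in F_K$ such that $v\hat v^{-1}\in (F_K\cap N)^F M$. -/

import Mathlib

namespace FoxCalculus

open Monoid

/-- The free product of the groups `A i` (`i ∈ I`) and of the free group with basis indexed by `J`. -/
abbrev FreeProd {I : Type*} (A : I → Type*) [∀ i, Group (A i)] (J : Type*) :=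
  Coprod (CoprodI A) (FreeGroup J)

section

variable {I J : Type*} {A : I → Type*} [∀ i, Group (A i)]

/-- The embedding of the free factor `A i`. -/
def factor (J : Type*) (i : I) : A i →* FreeProd A J :=
  Coprod.inl.comp CoprodI.of

/-- The basis element `g_j` of the free group factor. -/
def gen (A : I → Type*) [∀ i, Group (A i)] (j : J) : FreeProd A J :=
  Coprod.inr (FreeGroup.of j)

/-- The subgroup `F_K` generated by the `A i` with `i ∈ K` and the `g_j` with `j ∈ K`. -/
def subgroupOn (A : I → Type*) [∀ i, Group (A i)] (K : Set (I ⊕ J)) : Subgroup (FreeProd A J) :=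
  Subgroup.closure
    ({x | ∃ i, Sum.inl i ∈ K ∧ ∃ a : A i, x = factor J i a} ∪
      {x | ∃ j, Sum.inr j ∈ K ∧ x = gen A j})

/-- The product `M` of the subgroup generated by all the `(N ∩ A i)^F` with `[N, N]`. For normal
`N` both factors are normal subgroups, so their product is their join. -/
def subgroupM (N : Subgroup (FreeProd A J)) : Subgroup (FreeProd A J) :=
  (⨆ i : I, Subgroup.normalClosure
    ((N ⊓ (factor J i : A i →* FreeProd A J).range : Subgroup (FreeProd A J)) :
      Set (FreeProd A J))) ⊔ ⁅N, N⁆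

end

noncomputable section

/-- The augmentation `ε` of the integral group ring. -/
def augmentation (G : Type*) [Group G] : MonoidAlgebra ℤ G →ₐ[ℤ] ℤ :=
  MonoidAlgebra.lift ℤ ℤ G 1

/-- Congruence to `0` modulo a normal subgroup `N`: the image in the group ring of `G ⧸ N` is `0`. -/
def VanishesMod {G : Type*} [Group G] (N : Subgroup G) [N.Normal] (u : MonoidAlgebra ℤ G) : Prop :=
  MonoidAlgebra.mapDomainRingHom ℤ (QuotientGroup.mk' N) u = 0

variable {I J : Type*} {A : I → Type*} [∀ i, Group (A i)]

open Classical in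
/-- On `A i`, the matrices `(1, D_k a; 0, a)`, where `D_k a` is `a - 1` if `k = i`, else `0`. -/
def factorMatrix (k : I ⊕ J) (i : I) :
    A i →* Matrix (Fin 2) (Fin 2) (MonoidAlgebra ℤ (FreeProd A J)) where
  toFun a := !![1, if k = Sum.inl i then MonoidAlgebra.of ℤ _ (factor J i a) - 1 else 0;
    0, MonoidAlgebra.of ℤ _ (factor J i a)]
  map_one' := by
    simp only [map_one]
    simp [Matrix.one_fin_two]
  map_mul' a b := by
    simp only [map_mul, Matrix.mul_fin_two]
    split_ifs <;> simp [sub_mul]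

open Classical in
/-- The invertible matrix `(1, D_k g_j; 0, g_j)`, where `D_k g_j` is `1` if `k = j`, else `0`. -/
def genMatrix (k : I ⊕ J) (j : J) :
    (Matrix (Fin 2) (Fin 2) (MonoidAlgebra ℤ (FreeProd A J)))ˣ where
  val := !![1, if k = Sum.inr j then 1 else 0; 0, MonoidAlgebra.of ℤ _ (gen A j)]
  inv := !![1, if k = Sum.inr j then - MonoidAlgebra.of ℤ _ (gen A j)⁻¹ else 0;
    0, MonoidAlgebra.of ℤ _ (gen A j)⁻¹]
  val_inv := by
    rw [Matrix.mul_fin_two, Matrix.one_fin_two, ← map_mul]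
    split_ifs <;> simp [MonoidAlgebra.one_def]
  inv_val := by
    rw [Matrix.mul_fin_two, Matrix.one_fin_two, ← map_mul]
    split_ifs <;> simp [MonoidAlgebra.one_def]

/-- The ring homomorphism `u ↦ (ε u, D_k u; 0, u)`: a map `D` satisfies
`D (u v) = D u * v + ε u * D v` exactly when `u ↦ (ε u, D u; 0, u)` is multiplicative. -/
def foxMatrix (k : I ⊕ J) : MonoidAlgebra ℤ (FreeProd A J) →ₐ[ℤ]
    Matrix (Fin 2) (Fin 2) (MonoidAlgebra ℤ (FreeProd A J)) :=
  MonoidAlgebra.lift ℤ _ _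
    (Coprod.lift (CoprodI.lift (factorMatrix k))
      ((Units.coeHom _).comp (FreeGroup.lift (genMatrix k))))

/-- The Fox derivative `D_k` of the group ring; it is characterized by `isFox_foxD` and
`IsFox.eq_foxD` below. -/
def foxD (k : I ⊕ J) (u : MonoidAlgebra ℤ (FreeProd A J)) : MonoidAlgebra ℤ (FreeProd A J) :=
  foxMatrix k u 0 1

/-- The defining conditions of the Fox derivative `D_k`. -/
structure IsFox (k : I ⊕ J)
    (D : MonoidAlgebra ℤ (FreeProd A J) → MonoidAlgebra ℤ (FreeProd A J)) : Prop where
  add : ∀ u v, D (u + v) = D u + D v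
  mul : ∀ u v, D (u * v) = D u * v + augmentation _ u • D v
  gen_same : ∀ j, k = Sum.inr j → D (MonoidAlgebra.of ℤ _ (gen A j)) = 1
  gen_ne : ∀ j, k ≠ Sum.inr j → D (MonoidAlgebra.of ℤ _ (gen A j)) = 0
  factor_same : ∀ i (a : A i), k = Sum.inl i →
    D (MonoidAlgebra.of ℤ _ (factor J i a)) = MonoidAlgebra.of ℤ _ (factor J i a) - 1
  factor_ne : ∀ i (a : A i), k ≠ Sum.inl i → D (MonoidAlgebra.of ℤ _ (factor J i a)) = 0

theorem induction_gen {P : FreeProd A J → Prop} (x : FreeProd A J)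
    (h₁ : ∀ i (a : A i), P (factor J i a)) (h₂ : ∀ j, P (gen A j)) (h₃ : ∀ j, P (gen A j)⁻¹)
    (h_one : P 1) (h_mul : ∀ y z, P y → P z → P (y * z)) : P x := by
  induction x using Coprod.induction_on with
  | inl m =>
    induction m using CoprodI.induction_on with
    | one => simpa using h_one
    | of i a => exact h₁ i a
    | mul y z hy hz => simpa using h_mul _ _ hy hz
  | inr n =>
    induction n using FreeGroup.induction_on with
    | C1 => simpa using h_one
    | of j => exact h₂ j
    | inv_of j _ => simpa [gen] using h₃ j
    | mul y z hy hz => simpa using h_mul _ _ hy hz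
  | mul y z hy hz => exact h_mul _ _ hy hz

theorem foxMatrix_factor (k : I ⊕ J) (i : I) (a : A i) :
    foxMatrix k (MonoidAlgebra.of ℤ _ (factor J i a)) = factorMatrix k i a := by
  simp [foxMatrix, factor]

theorem foxMatrix_gen (k : I ⊕ J) (j : J) :
    foxMatrix k (MonoidAlgebra.of ℤ _ (gen A j)) = (genMatrix k j).val := by
  simp [foxMatrix, gen]

theorem foxMatrix_gen_inv (k : I ⊕ J) (j : J) :
    foxMatrix k (MonoidAlgebra.of ℤ _ (gen A j)⁻¹) = (genMatrix k j).inv := by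
  have e : (gen A j)⁻¹ = (Coprod.inr (FreeGroup.of j)⁻¹ : FreeProd A J) := (map_inv _ _).symm
  rw [e, foxMatrix, MonoidAlgebra.lift_of, Coprod.lift_apply_inr, MonoidHom.comp_apply, map_inv,
    FreeGroup.lift_apply_of]
  rfl

theorem foxMatrix_eq (k : I ⊕ J) (u : MonoidAlgebra ℤ (FreeProd A J)) :
    foxMatrix k u = !![algebraMap ℤ _ (augmentation _ u), foxD k u; 0, u] := by
  have h : ∀ x : FreeProd A J, foxMatrix k (MonoidAlgebra.of ℤ _ x) =
      !![1, foxD k (MonoidAlgebra.of ℤ _ x); 0, MonoidAlgebra.of ℤ _ x] := by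
    intro x
    induction x using induction_gen with
    | h₁ i a => simp only [foxD, foxMatrix_factor]; simp [factorMatrix]
    | h₂ j => simp only [foxD, foxMatrix_gen]; simp [genMatrix]
    | h₃ j => simp only [foxD, foxMatrix_gen_inv]; simp [genMatrix]
    | h_one => simp only [foxD, map_one]; simp [Matrix.one_fin_two]
    | h_mul y z hy hz =>
      rw [foxD, map_mul, map_mul, hy, hz, Matrix.mul_fin_two]; simp
  induction u using MonoidAlgebra.induction_on with
  | of x => rw [h]; simp [augmentation]
  | add u v hu hv =>
    simp only [foxD, map_add]
    rw [hu, hv]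
    simp
  | smul r u hu =>
    simp only [foxD, map_smul]
    rw [hu]
    simp

theorem isFox_foxD (k : I ⊕ J) : IsFox (A := A) k (foxD k) where
  add u v := by simp [foxD]
  mul u v := by
    have h := congrFun (congrFun (map_mul (foxMatrix (A := A) k) u v) 0) 1
    rw [foxMatrix_eq k u, foxMatrix_eq k v, Matrix.mul_fin_two] at h
    simpa [foxD, add_comm] using h
  gen_same j h := by simp only [foxD, foxMatrix_gen]; simp [genMatrix, h]
  gen_ne j h := by simp only [foxD, foxMatrix_gen]; simp [genMatrix, h]
  factor_same i a h := by simp only [foxD, foxMatrix_factor]; simp [factorMatrix, h]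
  factor_ne i a h := by simp only [foxD, foxMatrix_factor]; simp [factorMatrix, h]

theorem IsFox.eq_foxD {k : I ⊕ J}
    {D : MonoidAlgebra ℤ (FreeProd A J) → MonoidAlgebra ℤ (FreeProd A J)} (hD : IsFox k D) :
    D = foxD k := by
  have of_mul : ∀ {E : MonoidAlgebra ℤ (FreeProd A J) → MonoidAlgebra ℤ (FreeProd A J)},
      IsFox k E → ∀ y z : FreeProd A J, E (MonoidAlgebra.of ℤ _ (y * z)) =
        E (MonoidAlgebra.of ℤ _ y) * MonoidAlgebra.of ℤ _ z + E (MonoidAlgebra.of ℤ _ z) := by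
    intro E hE y z
    rw [map_mul, hE.mul]
    simp [augmentation]
  have of_one : ∀ {E : MonoidAlgebra ℤ (FreeProd A J) → MonoidAlgebra ℤ (FreeProd A J)},
      IsFox k E → E (MonoidAlgebra.of ℤ _ 1) = 0 := by
    intro E hE
    have h := of_mul hE 1 1
    rw [mul_one, map_one, mul_one] at h
    rw [map_one]
    simpa using h
  have of_inv : ∀ {E : MonoidAlgebra ℤ (FreeProd A J) → MonoidAlgebra ℤ (FreeProd A J)},
      IsFox k E → ∀ y : FreeProd A J, E (MonoidAlgebra.of ℤ _ y⁻¹) =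
        - (E (MonoidAlgebra.of ℤ _ y) * MonoidAlgebra.of ℤ _ y⁻¹) := by
    intro E hE y
    have h := of_mul hE y y⁻¹
    rw [mul_inv_cancel, of_one hE] at h
    exact (neg_eq_of_add_eq_zero_right h.symm).symm
  have hF := isFox_foxD (A := A) k
  have h : ∀ x : FreeProd A J, D (MonoidAlgebra.of ℤ _ x) = foxD k (MonoidAlgebra.of ℤ _ x) := by
    have hg : ∀ j, D (MonoidAlgebra.of ℤ _ (gen A j)) = foxD k (MonoidAlgebra.of ℤ _ (gen A j)) := by
      intro j
      by_cases hk : k = Sum.inr j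
      · rw [hD.gen_same j hk, hF.gen_same j hk]
      · rw [hD.gen_ne j hk, hF.gen_ne j hk]
    intro x
    induction x using induction_gen with
    | h₁ i a =>
      by_cases hk : k = Sum.inl i
      · rw [hD.factor_same i a hk, hF.factor_same i a hk]
      · rw [hD.factor_ne i a hk, hF.factor_ne i a hk]
    | h₂ j => exact hg j
    | h₃ j => rw [of_inv hD, of_inv hF, hg]
    | h_one => rw [of_one hD, of_one hF]
    | h_mul y z hy hz => rw [of_mul hD, of_mul hF, hy, hz]
  funext u
  induction u using MonoidAlgebra.induction_on with
  | of x => exact h x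
  | add u v hu hv => rw [hD.add, hF.add, hu, hv]
  | smul r u hu =>
    have e₁ := map_zsmul (AddMonoidHom.mk' D hD.add) r u
    have e₂ := map_zsmul (AddMonoidHom.mk' (foxD k) hF.add) r u
    simp only [AddMonoidHom.mk'_apply] at e₁ e₂
    rw [e₁, e₂, hu]

end

end FoxCalculus

/-! ### Cocycles with values in functions on `G ⧸ N` -/

namespace FoxCalculus

/-! Fox derivatives modulo `N` are universal: a cocycle that is a coboundary on each `A i` is a sum
of functionals applied to them (`IsCocycle.eq_sum_pairing`). Being a coboundary on `A i` only
requires vanishing on `A i ∩ N` (`IsCocycle.exists_primitive`). If the cocycle also vanishes on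
`F_K`, the terms with `k ∈ K` drop out, so it kills every `v` satisfying condition 1.

Two cocycles then give 1 ⇒ 2. The coboundary of the indicator of the image of `F_K` in `F/N` shows
`v ∈ F_K N`. For `x = v w⁻¹ ∈ N`, let `L = (F_K ∩ N)^F M`; the Schreier cocycle with values in `N/L`
detects `L` on `N`, and subtracting a coboundary makes it vanish on `F_K` without changing it on
`N`.

Conversely, the elements of `N` with derivative zero modulo `N` form a normal subgroup containing
all generators of `L`. -/

/-- A 1-cocycle of `G` with values in the functions `G ⧸ N → H`. -/
def IsCocycle {G H : Type*} [Group G] [AddCommGroup H] (N : Subgroup G) [N.Normal]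
    (c : G ⧸ N → G → H) : Prop :=
  ∀ q x y, c q (x * y) = c (y * q) x + c q y

namespace IsCocycle

variable {G H : Type*} [Group G] [AddCommGroup H] {N : Subgroup G} [N.Normal]
  {c : G ⧸ N → G → H}

theorem map_one (hc : IsCocycle N c) (q : G ⧸ N) : c q 1 = 0 := by
  simpa using hc q 1 1

theorem map_inv (hc : IsCocycle N c) (q : G ⧸ N) (x : G) :
    c q x⁻¹ = -c ((x⁻¹ : G) * q) x := by
  have h := hc q x x⁻¹
  rw [mul_inv_cancel, hc.map_one] at h
  exact (neg_eq_of_add_eq_zero_right h.symm).symm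

theorem coboundary (φ : G ⧸ N → H) : IsCocycle N fun q x => φ (x * q) - φ q := by
  intro q x y
  simp [mul_assoc]

theorem sub {d : G ⧸ N → G → H} (hc : IsCocycle N c) (hd : IsCocycle N d) :
    IsCocycle N fun q x => c q x - d q x := by
  intro q x y
  simp only [hc q x y, hd q x y]
  abel

/-- A cocycle that vanishes on `S ⊓ N` is a coboundary on `S`. -/
theorem exists_primitive (hc : IsCocycle N c) (S : Subgroup G)
    (h : ∀ q, ∀ x ∈ S, x ∈ N → c q x = 0) :
    ∃ φ : G ⧸ N → H, ∀ q, ∀ x ∈ S, c q x = φ (x * q) - φ q := by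
  -- On `S` the cocycle depends only on the class modulo `N`.
  have key : ∀ r, ∀ x ∈ S, ∀ y ∈ S, (x : G ⧸ N) = y → c r x = c r y := by
    intro r x hx y hy hxy
    have hN : y⁻¹ * x ∈ N := QuotientGroup.eq.1 hxy.symm
    have e := hc r y (y⁻¹ * x)
    rw [mul_inv_cancel_left, h r _ (S.mul_mem (S.inv_mem hy) hx) hN, add_zero,
      (QuotientGroup.eq_one_iff _).2 hN, one_mul] at e
    exact e
  -- Orbits of `S` on `G ⧸ N`: `r q` is a base point of the orbit of `q`, and `b q ∈ S` carries it
  -- to `q`. The primitive integrates `c` from `r q` to `q`.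
  let R : Setoid (G ⧸ N) :=
    { r := fun p q => ∃ x ∈ S, (x : G ⧸ N) * p = q
      iseqv :=
        { refl := fun p => ⟨1, S.one_mem, by simp⟩
          symm := by
            rintro p q ⟨x, hx, rfl⟩
            exact ⟨x⁻¹, S.inv_mem hx, by simp⟩
          trans := by
            rintro p q r ⟨x, hx, rfl⟩ ⟨y, hy, rfl⟩
            exact ⟨y * x, S.mul_mem hy hx, by simp [mul_assoc]⟩ } }
  let r : G ⧸ N → G ⧸ N := fun q => (Quotient.mk R q).out
  have hr : ∀ q, ∃ x ∈ S, (x : G ⧸ N) * r q = q := fun q => Quotient.mk_out (s := R) q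
  have hr' : ∀ q, ∀ x ∈ S, r (x * q) = r q := fun q x hx =>
    congrArg Quotient.out (Quotient.sound (s := R) (show R.r q (x * q) from ⟨x, hx, rfl⟩)).symm
  choose b hbS hb using hr
  refine ⟨fun q => c (r q) (b q), fun q x hx => ?_⟩
  have e := hc (r q) x (b q)
  rw [hb] at e
  rw [eq_sub_iff_add_eq, ← e]
  simp only [hr' q x hx]
  -- Both `x * b q` and `b (x * q)` carry `r q` to `x * q`, so they agree modulo `N`.
  refine key _ _ (S.mul_mem hx (hbS q)) _ (hbS _) ?_
  have e' := hb (x * q)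
  rw [hr' q x hx] at e'
  refine mul_right_cancel (b := r q) ?_
  rw [e', QuotientGroup.mk_mul, mul_assoc, hb]

end IsCocycle

/-! ### Functions on a group as functionals on its group ring -/

section

variable {Q H : Type*} [Group Q] [AddCommGroup H]

/-- The additive extension of `p ↦ φ (p * q)` to the integral group ring. -/
noncomputable def pairing (φ : Q → H) (q : Q) : MonoidAlgebra ℤ Q →+ H :=
  (Finsupp.liftAddHom fun p => (zmultiplesHom H) (φ (p * q))).comp
    (MonoidAlgebra.coeffAddEquiv (R := ℤ) (M := Q)).toAddMonoidHom

theorem pairing_of (φ : Q → H) (q p : Q) : pairing φ q (MonoidAlgebra.of ℤ Q p) = φ (p * q) := by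
  simp [pairing]

theorem pairing_zero (q : Q) : pairing (0 : Q → H) q = 0 := by
  ext
  simp [pairing]

/-- Matches the right factor in the product rule for Fox derivatives with the shift of base point in
the cocycle identity. -/
theorem pairing_mul_of (φ : Q → H) (q p : Q) (u : MonoidAlgebra ℤ Q) :
    pairing φ q (u * MonoidAlgebra.of ℤ Q p) = pairing φ (p * q) u := by
  induction u using MonoidAlgebra.induction_on with
  | of x => rw [← map_mul, pairing_of, pairing_of, mul_assoc]
  | add u v hu hv => rw [add_mul, map_add, map_add, hu, hv]
  | smul r u hu => rw [smul_mul_assoc, map_zsmul, map_zsmul, hu]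

end

/-! ### Fox derivatives modulo `N` and their universality -/

section

variable {I J : Type*} {A : I → Type*} [∀ i, Group (A i)]

/-- The Fox derivative of a group element, reduced modulo `N`. -/
noncomputable def foxMod (N : Subgroup (FreeProd A J)) [N.Normal] (k : I ⊕ J)
    (x : FreeProd A J) : MonoidAlgebra ℤ (FreeProd A J ⧸ N) :=
  MonoidAlgebra.mapDomainRingHom ℤ (QuotientGroup.mk' N) (foxD k (MonoidAlgebra.of ℤ _ x))

variable (N : Subgroup (FreeProd A J)) [N.Normal] (k : I ⊕ J)

theorem mapDomainRingHom_mk_of (x : FreeProd A J) :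
    MonoidAlgebra.mapDomainRingHom ℤ (QuotientGroup.mk' N) (MonoidAlgebra.of ℤ _ x) =
      MonoidAlgebra.of ℤ (FreeProd A J ⧸ N) x := by
  simp

theorem foxMod_mul (x y : FreeProd A J) :
    foxMod N k (x * y) = foxMod N k x * MonoidAlgebra.of ℤ (FreeProd A J ⧸ N) y + foxMod N k y := by
  have h : augmentation _ (MonoidAlgebra.of ℤ (FreeProd A J) x) = 1 := by simp [augmentation]
  rw [foxMod, map_mul, (isFox_foxD k).mul, h, one_smul, map_add, map_mul, mapDomainRingHom_mk_of]
  rfl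

theorem foxMod_one : foxMod N k 1 = 0 := by
  have h := foxMod_mul N k 1 1
  rw [QuotientGroup.mk_one, map_one, mul_one, mul_one] at h
  simpa using h

theorem foxMod_inv (x : FreeProd A J) :
    foxMod N k x⁻¹ =
      -(foxMod N k x * MonoidAlgebra.of ℤ (FreeProd A J ⧸ N) (x⁻¹ : FreeProd A J)) := by
  have h := foxMod_mul N k x x⁻¹
  rw [mul_inv_cancel, foxMod_one] at h
  exact (neg_eq_of_add_eq_zero_right h.symm).symm

open Classical in
theorem foxMod_factor (i : I) (a : A i) :
    foxMod N k (factor J i a) = if k = Sum.inl i then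
      MonoidAlgebra.of ℤ (FreeProd A J ⧸ N) (factor J i a) - 1 else 0 := by
  split_ifs with h
  · rw [foxMod, (isFox_foxD k).factor_same i a h, map_sub, map_one, mapDomainRingHom_mk_of]
  · rw [foxMod, (isFox_foxD k).factor_ne i a h, map_zero]

open Classical in
theorem foxMod_gen (j : J) : foxMod N k (gen A j) = if k = Sum.inr j then 1 else 0 := by
  split_ifs with h
  · rw [foxMod, (isFox_foxD k).gen_same j h, map_one]
  · rw [foxMod, (isFox_foxD k).gen_ne j h, map_zero]

variable {N k}

theorem foxMod_eq_zero_of_mem_subgroupOn {K : Set (I ⊕ J)} (hk : k ∉ K) {x : FreeProd A J}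
    (hx : x ∈ subgroupOn A K) : foxMod N k x = 0 := by
  induction hx using Subgroup.closure_induction with
  | mem x hx =>
    rcases hx with ⟨i, hi, a, rfl⟩ | ⟨j, hj, rfl⟩
    · rw [foxMod_factor, if_neg (by rintro rfl; exact hk hi)]
    · rw [foxMod_gen, if_neg (by rintro rfl; exact hk hj)]
  | one => exact foxMod_one N k
  | mul x y _ _ hx hy => rw [foxMod_mul, hx, hy, zero_mul, add_zero]
  | inv x _ hx => rw [foxMod_inv, hx, zero_mul, neg_zero]

variable (N k) in
/-- The elements of `N` whose Fox derivative vanishes modulo `N`. -/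
def foxKernel : Subgroup (FreeProd A J) where
  carrier := {x | x ∈ N ∧ foxMod N k x = 0}
  one_mem' := ⟨N.one_mem, foxMod_one N k⟩
  mul_mem' := by
    rintro x y ⟨hx, hx'⟩ ⟨hy, hy'⟩
    exact ⟨N.mul_mem hx hy, by rw [foxMod_mul, hx', hy', zero_mul, add_zero]⟩
  inv_mem' := by
    rintro x ⟨hx, hx'⟩
    exact ⟨N.inv_mem hx, by rw [foxMod_inv, hx', zero_mul, neg_zero]⟩

theorem of_mk_eq_one {x : FreeProd A J} (hx : x ∈ N) :
    MonoidAlgebra.of ℤ (FreeProd A J ⧸ N) x = 1 := by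
  rw [(QuotientGroup.eq_one_iff x).2 hx, map_one]

instance foxKernel_normal : (foxKernel N k).Normal where
  conj_mem := by
    rintro x ⟨hx, hx'⟩ y
    refine ⟨‹N.Normal›.conj_mem x hx y, ?_⟩
    rw [foxMod_mul, foxMod_mul, hx', of_mk_eq_one hx, mul_one, add_zero, ← foxMod_mul,
      mul_inv_cancel, foxMod_one]

/-- Elements of `N` become `1` in the group ring of `F/N`, so on `N` the derivative is a
homomorphism to an abelian group. -/
theorem commutator_le_foxKernel : ⁅N, N⁆ ≤ foxKernel N k := by
  rw [Subgroup.commutator_le]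
  intro x hx y hy
  refine ⟨N.mul_mem (N.mul_mem (N.mul_mem hx hy) (N.inv_mem hx)) (N.inv_mem hy), ?_⟩
  rw [commutatorElement_def, foxMod_mul, foxMod_mul, foxMod_mul, foxMod_inv, foxMod_inv,
    of_mk_eq_one hy, of_mk_eq_one (N.inv_mem hx), of_mk_eq_one (N.inv_mem hy)]
  simp

theorem subgroupM_le_foxKernel : subgroupM N ≤ foxKernel N k := by
  refine sup_le (iSup_le fun i => Subgroup.normalClosure_le_normal ?_) commutator_le_foxKernel
  rintro _ ⟨hN, a, rfl⟩
  refine ⟨hN, ?_⟩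
  rw [foxMod_factor, of_mk_eq_one hN]
  simp

theorem normalClosure_le_foxKernel {K : Set (I ⊕ J)} (hk : k ∉ K) :
    Subgroup.normalClosure ((subgroupOn A K ⊓ N : Subgroup (FreeProd A J)) : Set (FreeProd A J)) ≤
      foxKernel N k :=
  Subgroup.normalClosure_le_normal fun _ hx => ⟨hx.2, foxMod_eq_zero_of_mem_subgroupOn hk hx.1⟩

/-- A cocycle that is a coboundary on every `A i` is determined by the Fox derivatives. -/
theorem IsCocycle.eq_sum_pairing {H : Type*} [AddCommGroup H]
    {c : FreeProd A J ⧸ N → FreeProd A J → H}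
    (hc : IsCocycle N c) (φ : I ⊕ J → FreeProd A J ⧸ N → H)
    (hf : ∀ i (a : A i) q, c q (factor J i a) = φ (Sum.inl i) (factor J i a * q) - φ (Sum.inl i) q)
    (hg : ∀ j q, c q (gen A j) = φ (Sum.inr j) q) (x : FreeProd A J) :
    ∃ S : Finset (I ⊕ J), ∀ T, S ⊆ T → ∀ q, c q x = ∑ k ∈ T, pairing (φ k) q (foxMod N k x) := by
  classical
  have h1 : ∀ (ψ : FreeProd A J ⧸ N → H) q, pairing ψ q 1 = ψ q := fun ψ q => by
    rw [← _root_.map_one (MonoidAlgebra.of ℤ (FreeProd A J ⧸ N)), pairing_of, one_mul]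
  have hgen : ∀ j (T : Finset (I ⊕ J)), {Sum.inr j} ⊆ T → ∀ q,
      c q (gen A j) = ∑ k ∈ T, pairing (φ k) q (foxMod N k (gen A j)) := by
    intro j T hT q
    rw [Finset.sum_eq_single_of_mem (Sum.inr j) (by simpa using hT)
      fun k _ hk => by rw [foxMod_gen, if_neg hk, map_zero], foxMod_gen, if_pos rfl, hg, h1]
  induction x using induction_gen with
  | h₁ i a =>
    refine ⟨{Sum.inl i}, fun T hT q => ?_⟩
    rw [Finset.sum_eq_single_of_mem (Sum.inl i) (by simpa using hT)
      fun k _ hk => by rw [foxMod_factor, if_neg hk, map_zero], foxMod_factor, if_pos rfl, hf,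
      map_sub, pairing_of, h1]
  | h₂ j => exact ⟨{Sum.inr j}, hgen j⟩
  | h₃ j =>
    refine ⟨{Sum.inr j}, fun T hT q => ?_⟩
    rw [hc.map_inv, hgen j T hT, ← Finset.sum_neg_distrib]
    exact Finset.sum_congr rfl fun k _ => by rw [foxMod_inv, map_neg, pairing_mul_of]
  | h_one => exact ⟨∅, fun T _ q => by simp [hc.map_one, foxMod_one]⟩
  | h_mul y z hy hz =>
    obtain ⟨S, hS⟩ := hy
    obtain ⟨S', hS'⟩ := hz
    -- The formula holds for all larger index sets, so both factors can use the same `T`.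
    refine ⟨S ∪ S', fun T hT q => ?_⟩
    rw [hc, hS T (Finset.union_subset_left hT), hS' T (Finset.union_subset_right hT),
      ← Finset.sum_add_distrib]
    exact Finset.sum_congr rfl fun k _ => by rw [foxMod_mul, map_add, pairing_mul_of]

theorem factor_mem_subgroupOn {K : Set (I ⊕ J)} {i : I} (hi : Sum.inl i ∈ K) (a : A i) :
    factor J i a ∈ subgroupOn A K :=
  Subgroup.subset_closure (Or.inl ⟨i, hi, a, rfl⟩)

theorem gen_mem_subgroupOn {K : Set (I ⊕ J)} {j : J} (hj : Sum.inr j ∈ K) :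
    gen A j ∈ subgroupOn A K :=
  Subgroup.subset_closure (Or.inr ⟨j, hj, rfl⟩)

/-- A cocycle that vanishes on `subgroupOn A K` and on every `A i ⊓ N` vanishes on the elements
whose Fox derivatives outside `K` vanish modulo `N`. -/
theorem IsCocycle.eq_zero_of_foxMod_eq_zero {H : Type*} [AddCommGroup H]
    {c : FreeProd A J ⧸ N → FreeProd A J → H} (hc : IsCocycle N c) {K : Set (I ⊕ J)}
    (hK : ∀ q, ∀ x ∈ subgroupOn A K, c q x = 0)
    (hA : ∀ i (a : A i) q, factor J i a ∈ N → c q (factor J i a) = 0)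
    {x : FreeProd A J} (hx : ∀ k ∉ K, foxMod N k x = 0) (q : FreeProd A J ⧸ N) : c q x = 0 := by
  classical
  have hprim : ∀ i, ∃ ψ : FreeProd A J ⧸ N → H,
      ∀ (a : A i) q, c q (factor J i a) = ψ (factor J i a * q) - ψ q := by
    intro i
    obtain ⟨ψ, hψ⟩ := hc.exists_primitive (factor J i).range
      (by rintro q _ ⟨a, rfl⟩ ha; exact hA i a q ha)
    exact ⟨ψ, fun a q => hψ q _ ⟨a, rfl⟩⟩
  choose ψ hψ using hprim
  -- Since `c` vanishes on `F_K`, the coefficient functions for `k ∈ K` may be taken to be zero.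
  let φ : I ⊕ J → FreeProd A J ⧸ N → H := fun k =>
    if k ∈ K then 0 else Sum.elim ψ (fun j q => c q (gen A j)) k
  obtain ⟨S, hS⟩ := hc.eq_sum_pairing φ
    (by
      intro i a q
      by_cases hi : Sum.inl i ∈ K
      · simp [φ, hi, hK q _ (factor_mem_subgroupOn hi a)]
      · simp [φ, hi, hψ i a q])
    (by
      intro j q
      by_cases hj : Sum.inr j ∈ K
      · simp [φ, hj, hK q _ (gen_mem_subgroupOn hj)]
      · simp [φ, hj]) x
  rw [hS S subset_rfl]
  refine Finset.sum_eq_zero fun k _ => ?_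
  by_cases hk : k ∈ K
  · have : φ k = 0 := if_pos hk
    rw [this, pairing_zero, AddMonoidHom.zero_apply]
  · rw [hx k hk, map_zero]

/-- If the Fox derivatives of `x` outside `K` vanish modulo `N`, then `x` is congruent modulo `N`
to an element of `subgroupOn A K`. -/
theorem exists_mem_subgroupOn_of_foxMod_eq_zero {K : Set (I ⊕ J)} {x : FreeProd A J}
    (hx : ∀ k ∉ K, foxMod N k x = 0) : ∃ w ∈ subgroupOn A K, x * w⁻¹ ∈ N := by
  classical
  let B : Subgroup (FreeProd A J ⧸ N) := (subgroupOn A K).map (QuotientGroup.mk' N)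
  let f : FreeProd A J ⧸ N → ℤ := fun q => if q ∈ B then 1 else 0
  -- Left translation by `F_K` preserves `B`, so this coboundary vanishes on `F_K`; its value at `1`
  -- compares `f x` with `f 1 = 1`.
  have h := (IsCocycle.coboundary (N := N) f).eq_zero_of_foxMod_eq_zero (K := K)
    (by
      intro q y hy
      have hy' : (y : FreeProd A J ⧸ N) ∈ B := ⟨y, hy, rfl⟩
      simp only [f, B.mul_mem_cancel_left hy', sub_self])
    (by
      intro i a q ha
      rw [(QuotientGroup.eq_one_iff _).2 ha, one_mul, sub_self]) hx 1
  have hB : (x : FreeProd A J ⧸ N) ∈ B := by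
    by_contra hB
    simp [f, hB, B.one_mem] at h
  obtain ⟨w, hw, hwx⟩ := hB
  refine ⟨w, hw, ?_⟩
  rw [← QuotientGroup.eq_one_iff, QuotientGroup.mk_mul, QuotientGroup.mk_inv, ← hwx]
  exact mul_inv_cancel _

end

/-! ### The Schreier cocycle with values in `N ⧸ (N ⊓ L)` -/

section

universe u

variable {G : Type u} [Group G] (N L : Subgroup G) [N.Normal] [L.Normal]

/-- The group `N ⧸ (N ⊓ L)` is commutative when `L` contains the commutators of `N`. -/
@[reducible]
def quotientCommGroup (h : ⁅N, N⁆ ≤ L) : CommGroup (N ⧸ L.subgroupOf N) :=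
  { (inferInstance : Group (N ⧸ L.subgroupOf N)) with
    mul_comm := by
      rintro ⟨x⟩ ⟨y⟩
      refine QuotientGroup.eq.2 ?_
      rw [Subgroup.mem_subgroupOf]
      have := h (Subgroup.commutator_mem_commutator (N.inv_mem y.2) (N.inv_mem x.2))
      simpa [commutatorElement_def, mul_assoc] using this }

theorem inv_out_mul_mul_out_mem (q : G ⧸ N) (x : G) :
    ((x : G ⧸ N) * q).out⁻¹ * x * q.out ∈ N := by
  rw [mul_assoc, ← QuotientGroup.eq]
  simp

/-- There is a cocycle that detects membership in `L` of the elements of `N`. -/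
theorem exists_cocycle_eq_zero_iff (h : ⁅N, N⁆ ≤ L) :
    ∃ (H : Type u) (_ : AddCommGroup H) (c : G ⧸ N → G → H), IsCocycle N c ∧
      ∀ q, ∀ x ∈ N, c q x = 0 ↔ x ∈ L := by
  let := quotientCommGroup N L h
  refine ⟨Additive (N ⧸ L.subgroupOf N), inferInstance, fun q x =>
    Additive.ofMul (QuotientGroup.mk ⟨_, inv_out_mul_mul_out_mem N q x⟩), ?_, ?_⟩
  · intro q x y
    rw [← ofMul_mul]
    refine congrArg Additive.ofMul ((congrArg QuotientGroup.mk (Subtype.ext ?_)).trans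
      (QuotientGroup.mk_mul _ _ _))
    simp [mul_assoc]
  · intro q x hx
    rw [ofMul_eq_zero]
    refine (QuotientGroup.eq_one_iff _).trans ?_
    rw [Subgroup.mem_subgroupOf]
    -- An element of `N` fixes `q`, so its value is the class of its conjugate by `q.out`.
    simp only [(QuotientGroup.eq_one_iff x).2 hx, one_mul]
    constructor
    · intro hL
      simpa [mul_assoc] using ‹L.Normal›.conj_mem _ hL q.out
    · intro hL
      simpa [mul_assoc] using ‹L.Normal›.conj_mem _ hL q.out⁻¹

end

/-! ### Elements of `N` with vanishing derivatives -/

section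

variable {I J : Type*} {A : I → Type*} [∀ i, Group (A i)] {N : Subgroup (FreeProd A J)} [N.Normal]

instance subgroupM_normal : (subgroupM N).Normal := by
  have : (⨆ i : I, Subgroup.normalClosure
      ((N ⊓ (factor J i : A i →* FreeProd A J).range : Subgroup (FreeProd A J)) :
        Set (FreeProd A J))).Normal := Subgroup.iSup_normal _
  exact Subgroup.sup_normal _ _

/-- An element of `N` whose Fox derivatives outside `K` vanish modulo `N` lies in the normal
subgroup generated by `subgroupOn A K ⊓ N` and `subgroupM N`. -/
theorem mem_of_foxMod_eq_zero {K : Set (I ⊕ J)} {x : FreeProd A J} (hxN : x ∈ N)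
    (hx : ∀ k ∉ K, foxMod N k x = 0) :
    x ∈ Subgroup.normalClosure
        ((subgroupOn A K ⊓ N : Subgroup (FreeProd A J)) : Set (FreeProd A J)) ⊔ subgroupM N := by
  set L := Subgroup.normalClosure
    ((subgroupOn A K ⊓ N : Subgroup (FreeProd A J)) : Set (FreeProd A J)) ⊔ subgroupM N with hL
  have hLn : L.Normal := Subgroup.sup_normal _ _
  have hcomm : ⁅N, N⁆ ≤ L := le_sup_right.trans (le_sup_right (a := Subgroup.normalClosure _))
  obtain ⟨H, _, c, hc, hcL⟩ := exists_cocycle_eq_zero_iff N L hcomm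
  obtain ⟨φ, hφ⟩ := hc.exists_primitive (subgroupOn A K) fun q y hy hyN =>
    (hcL q y hyN).2 (le_sup_left (a := Subgroup.normalClosure _)
      (Subgroup.subset_normalClosure ⟨hy, hyN⟩))
  -- Coboundaries vanish on `N`, which acts trivially on `F/N`; the correction by `φ` keeps the
  -- detection of `L`.
  have key : ∀ q, ∀ y ∈ N, c q y - (φ (y * q) - φ q) = c q y := by
    intro q y hy
    rw [(QuotientGroup.eq_one_iff y).2 hy, one_mul, sub_self, sub_zero]
  rw [← hcL 1 x hxN, ← key 1 x hxN]
  refine (hc.sub (IsCocycle.coboundary φ)).eq_zero_of_foxMod_eq_zero (K := K)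
    (fun q y hy => sub_eq_zero.2 (hφ q y hy)) (fun i a q ha => ?_) hx 1
  rw [key q _ ha, hcL q _ ha]
  exact le_sup_right (a := Subgroup.normalClosure _) (le_sup_left (b := ⁅N, N⁆)
    (le_iSup (fun i : I => Subgroup.normalClosure
      ((N ⊓ (factor J i : A i →* FreeProd A J).range : Subgroup (FreeProd A J)) :
        Set (FreeProd A J))) i (Subgroup.subset_normalClosure ⟨ha, a, rfl⟩)))

end

end FoxCalculus

theorem theorem1 {I J : Type*} (A : I → Type*) [∀ i, Group (A i)] [∀ i, Nontrivial (A i)]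
    (K : Set (I ⊕ J)) (N : Subgroup (FoxCalculus.FreeProd A J)) [N.Normal]
    (v : FoxCalculus.FreeProd A J) :
    (∀ k : I ⊕ J, k ∉ K →
        FoxCalculus.VanishesMod N (FoxCalculus.foxD k (MonoidAlgebra.of ℤ _ v))) ↔
      ∃ w ∈ FoxCalculus.subgroupOn A K,
        v * w⁻¹ ∈ Subgroup.normalClosure
            ((FoxCalculus.subgroupOn A K ⊓ N : Subgroup (FoxCalculus.FreeProd A J)) :
              Set (FoxCalculus.FreeProd A J)) ⊔
          FoxCalculus.subgroupM N := by
  change (∀ k ∉ K, FoxCalculus.foxMod N k v = 0) ↔ _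
  constructor
  · intro h
    obtain ⟨w, hw, hN⟩ := FoxCalculus.exists_mem_subgroupOn_of_foxMod_eq_zero h
    refine ⟨w, hw, FoxCalculus.mem_of_foxMod_eq_zero hN fun k hk => ?_⟩
    rw [FoxCalculus.foxMod_mul, h k hk, zero_mul, zero_add,
      FoxCalculus.foxMod_eq_zero_of_mem_subgroupOn hk (inv_mem hw)]
  · rintro ⟨w, hw, h⟩ k hk
    have h' : v * w⁻¹ ∈ FoxCalculus.foxKernel N k :=
      sup_le (FoxCalculus.normalClosure_le_foxKernel hk) FoxCalculus.subgroupM_le_foxKernel h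
    rw [← inv_mul_cancel_right v w, FoxCalculus.foxMod_mul, h'.2, zero_mul, zero_add,
      FoxCalculus.foxMod_eq_zero_of_mem_subgroupOn hk hw]
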